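/- Let $n\in\mathbb{N}$ and let $f:\mathbb{R}^n\to\mathbb{R}$ be piecewise affine, that is, $f$ is continuous and there are finitely many affine functions $g_1,\dots,g_k:\mathbb{R}^n\to\mathbb{R}$ such that for every $x\in\mathbb{R}^n$ there is an $i$ with $f(x)=g_i(x)$. Let $f^\infty:\mathbb{R}^n\to\mathbb{R}\cup\{-\infty,+\infty\}$ be the horizon function of $f$, $$f^\infty(\xi)=\lim_{\delta\downarrow 0}\,\inf\bigl\{\lambda f(x/\lambda):\ 0<\lambda<\delta,\ x\in\mathbb{R}^n,\ \|x-\xi\|<\delta\bigr\},$$ where $\|\cdot\|$ is the Euclidean norm. Then $f$ has a global minimum on $\mathbb{R}^n$ (there is $x_0\in\mathbb{R}^n$ with $f(x_0)\le f(x)$ for all $x\in\mathbb{R}^n$) if and only if the equation $f^\infty(\xi)+1=0$ has no solution $\xi\in\mathbb{R}^n$. -/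

import Mathlib

open Filter Topology

/-- A continuous piecewise-affine function: a continuous function whose value at every point is
the value there of one of finitely many affine functions (the affine pieces). -/
def IsPiecewiseAffine {n : ℕ} {F : Type*} [NormedAddCommGroup F] [NormedSpace ℝ F]
    (f : EuclideanSpace ℝ (Fin n) → F) : Prop :=
  Continuous f ∧
    ∃ S : Set (EuclideanSpace ℝ (Fin n) →ᵃ[ℝ] F), S.Finite ∧ ∀ x, ∃ g ∈ S, f x = g x

/-- The infimum, in the extended reals, of `l * f (x / l)` over `0 < l < δ` and `‖x - ξ‖ < δ`. -/
noncomputable def horizonInf {n : ℕ} (f : EuclideanSpace ℝ (Fin n) → ℝ)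
    (ξ : EuclideanSpace ℝ (Fin n)) (δ : ℝ) : EReal :=
  sInf {t : EReal | ∃ (l : ℝ) (x : EuclideanSpace ℝ (Fin n)),
    0 < l ∧ l < δ ∧ ‖x - ξ‖ < δ ∧ t = ((l * f (l⁻¹ • x) : ℝ) : EReal)}

/-- The horizon function of `f`, with values in the extended reals: the limit of
`horizonInf f ξ δ` as `δ` decreases to `0` (it always exists, see `tendsto_horizonInf`). -/
noncomputable def horizonFunction {n : ℕ} (f : EuclideanSpace ℝ (Fin n) → ℝ)
    (ξ : EuclideanSpace ℝ (Fin n)) : EReal :=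
  limUnder (𝓝[>] (0 : ℝ)) (horizonInf f ξ)

theorem horizonInf_antitone {n : ℕ} (f : EuclideanSpace ℝ (Fin n) → ℝ)
    (ξ : EuclideanSpace ℝ (Fin n)) : Antitone (horizonInf f ξ) := by
  intro a b hab
  apply sInf_le_sInf
  rintro t ⟨l, x, h0, h1, h2, rfl⟩
  exact ⟨l, x, h0, h1.trans_le hab, h2.trans_le hab, rfl⟩

theorem tendsto_horizonInf {n : ℕ} (f : EuclideanSpace ℝ (Fin n) → ℝ)
    (ξ : EuclideanSpace ℝ (Fin n)) :
    Tendsto (horizonInf f ξ) (𝓝[>] (0 : ℝ)) (𝓝 (horizonFunction f ξ)) :=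
  tendsto_nhds_limUnder ⟨_, (horizonInf_antitone f ξ).tendsto_nhdsGT 0⟩

/-! A minimum `f x₀` bounds `l * f (x / l)` below by `l * f x₀`, which tends to 0, so the horizon
function is nonnegative and never -1.

Without a minimum, take points `x k` going to infinity, each strictly below all points of smaller
norm, whose directions converge to `d`. Far out, two affine pieces either agree on the whole ray
from `x k` along `d` or never meet on it, so `f` follows one piece there (`exists_descending_ray`).
The slope is negative because stepping back by `d` decreases the norm. Hence the horizon function is
negative at `d`; it is finite there by linear growth, and positive homogeneity rescales the value to
-1. -/

section GeneralLemmas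

variable {n : ℕ}

/-! ### Descending rays of piecewise affine functions -/

/-- On a preconnected set, a continuous selection of finitely many continuous functions coincides
with one of them as soon as it does so at one point, provided that each of the others agrees with
that function everywhere or nowhere on the set. -/
theorem eqOn_of_isPreconnected_of_forall_eq_or_ne {X : Type*} [TopologicalSpace X] {A : Set X}
    (hA : IsPreconnected A) {f g₀ : X → ℝ} {S : Set (X → ℝ)} (hS : S.Finite)
    (hf : Continuous f) (hg₀ : Continuous g₀) (hgc : ∀ g ∈ S, Continuous g)
    (hfS : ∀ x, ∃ g ∈ S, f x = g x)
    (hdich : ∀ g ∈ S, (∀ x ∈ A, g x = g₀ x) ∨ ∀ x ∈ A, g x ≠ g₀ x)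
    {a : X} (ha : a ∈ A) (hfa : f a = g₀ a) : ∀ x ∈ A, f x = g₀ x := by
  by_contra! hcon
  obtain ⟨b, hb, hfb⟩ := hcon
  let S' : Set (X → ℝ) := {g ∈ S | ∀ x ∈ A, g x ≠ g₀ x}
  have hS' : S'.Finite := hS.subset fun g hg => hg.1
  have hC : IsClosed (⋃ g ∈ S', {x | f x = g x}) :=
    hS'.isClosed_biUnion fun g hg => isClosed_eq hf (hgc g hg.1)
  have hcover : ∀ x ∈ A, f x ≠ g₀ x → x ∈ ⋃ g ∈ S', {x | f x = g x} := by
    intro x hx hne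
    obtain ⟨g, hg, hfg⟩ := hfS x
    refine Set.mem_biUnion (x := g) ⟨hg, ?_⟩ hfg
    rcases hdich g hg with h | h
    · exact absurd (hfg.trans (h x hx)) hne
    · exact h
  obtain ⟨x, hx, hx1, hx2⟩ := isPreconnected_closed_iff.1 hA _ _ (isClosed_eq hf hg₀) hC
    (fun x hx => by
      by_cases h : f x = g₀ x
      · exact Or.inl h
      · exact Or.inr (hcover x hx h))
    ⟨a, ha, hfa⟩ ⟨b, hb, hcover b hb hfb⟩
  simp only [Set.mem_iUnion] at hx2
  obtain ⟨g, hg, hfg⟩ := hx2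
  exact hg.2 x hx (hfg.symm.trans hx1)

/-- A continuous function without a global minimum has, arbitrarily far out, points that are
strictly below all points of smaller norm. -/
theorem exists_norm_gt_forall_lt_of_no_min {f : EuclideanSpace ℝ (Fin n) → ℝ} (hf : Continuous f)
    (hmin : ¬ ∃ x₀, ∀ x, f x₀ ≤ f x) (R : ℝ) (hR : 0 ≤ R) :
    ∃ x, R < ‖x‖ ∧ ∀ y, ‖y‖ < ‖x‖ → f x < f y := by
  obtain ⟨y, -, hy⟩ := (isCompact_closedBall (0 : EuclideanSpace ℝ (Fin n)) R).exists_isMinOn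
    ⟨0, by simpa using hR⟩ hf.continuousOn
  push Not at hmin
  obtain ⟨z, hz⟩ := hmin y
  -- The point wanted is the one nearest the origin in a sublevel set that misses the ball of radius
  -- `R`.
  obtain ⟨x, hx, hxd⟩ := (isClosed_le hf continuous_const : IsClosed {x | f x ≤ f z})
    |>.exists_infDist_eq_dist ⟨z, le_refl (f z)⟩ 0
  have hxmin : ∀ w, f w ≤ f z → ‖x‖ ≤ ‖w‖ := by
    intro w hw
    have := Metric.infDist_le_dist_of_mem (x := (0 : EuclideanSpace ℝ (Fin n)))
      (show w ∈ {x | f x ≤ f z} from hw)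
    rwa [hxd, dist_zero_left, dist_zero_left] at this
  refine ⟨x, ?_, fun w hw => ?_⟩
  · by_contra! h
    have h1 : f y ≤ f x := hy (by simpa using h)
    have h2 : f x ≤ f z := hx
    linarith
  · by_contra! h
    exact absurd (hxmin w (h.trans hx)) (not_le.2 hw)

theorem AffineMap.eval_add_smul {E : Type*} [AddCommGroup E] [Module ℝ E]
    (g : E →ᵃ[ℝ] ℝ) (x d : E) (t : ℝ) : g (x + t • d) = g x + t * g.linear d := by
  have := g.map_vadd x (t • d)
  simp only [vadd_eq_add, map_smul, smul_eq_mul] at this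
  rw [add_comm x, this, add_comm]

/-- A piecewise affine function without a global minimum is affine with negative slope along
some ray. -/
theorem IsPiecewiseAffine.exists_descending_ray {f : EuclideanSpace ℝ (Fin n) → ℝ}
    (hf : IsPiecewiseAffine f) (hmin : ¬ ∃ x₀, ∀ x, f x₀ ≤ f x) :
    ∃ (x d : EuclideanSpace ℝ (Fin n)) (m : ℝ), m < 0 ∧
      ∀ t : ℝ, 0 ≤ t → f (x + t • d) = f x + t * m := by
  obtain ⟨hfc, S, hSfin, hfS⟩ := hf
  choose x hxn hxlt using fun k : ℕ =>
    exists_norm_gt_forall_lt_of_no_min hfc hmin (k : ℝ) k.cast_nonneg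
  have hpos : ∀ k, 0 < ‖x k‖ := fun k => k.cast_nonneg.trans_lt (hxn k)
  -- A nonprincipal ultrafilter replaces successive passages to subsequences.
  let U : Ultrafilter ℕ := hyperfilter ℕ
  have hU : (U : Filter ℕ) ≤ atTop := Nat.hyperfilter_le_atTop
  have hnorm : Tendsto (fun k => ‖x k‖) U atTop :=
    (tendsto_atTop_mono (fun k => (hxn k).le) tendsto_natCast_atTop_atTop).mono_left hU
  let u : ℕ → EuclideanSpace ℝ (Fin n) := fun k => ‖x k‖⁻¹ • x k
  have hxu : ∀ k, x k = ‖x k‖ • u k := fun k => by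
    simp [u, smul_smul, (hpos k).ne']
  obtain ⟨d, hd, hud⟩ := (isCompact_sphere (0 : EuclideanSpace ℝ (Fin n)) 1).ultrafilter_le_nhds
    (U.map u) (by
      refine le_principal_iff.2 (Filter.mem_map.2 (Filter.univ_mem' fun k => ?_))
      simp [u, norm_smul, (hpos k).ne'])
  replace hud : Tendsto u U (𝓝 d) := hud
  have hd1 : ‖d‖ = 1 := by simpa using hd
  obtain ⟨g₀, hg₀, hfg₀⟩ : ∃ g ∈ S, ∀ᶠ k in (U : Filter ℕ), f (x k) = g (x k) := by
    have h : (⋃ g ∈ S, {k | f (x k) = g (x k)}) ∈ U := by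
      refine Filter.univ_mem' fun k => ?_
      obtain ⟨g, hg, h⟩ := hfS (x k)
      exact Set.mem_biUnion hg h
    exact (Ultrafilter.finite_biUnion_mem_iff hSfin).1 h
  have hcont : ∀ g : EuclideanSpace ℝ (Fin n) →ᵃ[ℝ] ℝ, Continuous g :=
    fun g => g.continuous_of_finiteDimensional
  -- The ray starts at `t = -1` so that it contains `x k - d`, which later decides the sign of the
  -- slope.
  have hdich : ∀ᶠ k in (U : Filter ℕ), ∀ g ∈ S, (∀ t : ℝ, -1 ≤ t → g (x k + t • d) = g₀ (x k + t • d))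
      ∨ ∀ t : ℝ, -1 ≤ t → g (x k + t • d) ≠ g₀ (x k + t • d) := by
    rw [Filter.eventually_all_finite hSfin]
    intro g _
    set p : EuclideanSpace ℝ (Fin n) →ᵃ[ℝ] ℝ := g - g₀ with hp
    have hpa : ∀ y, p y = g y - g₀ y := fun y => rfl
    by_cases hs : p.linear d = 0
    · refine Eventually.of_forall fun k => ?_
      have hconst : ∀ t : ℝ, p (x k + t • d) = p (x k) := fun t => by
        rw [p.eval_add_smul, hs, mul_zero, add_zero]
      by_cases h0 : p (x k) = 0
      · exact Or.inl fun t _ => sub_eq_zero.1 (by rw [← hpa, hconst, h0])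
      · exact Or.inr fun t _ h => h0 (by rw [← hconst t, hpa, h, sub_self])
    -- Here `p (x k)` grows like `‖x k‖ * p.linear d`, so the zero of `p` on the line lies at some
    -- `t < -1`.
    · have hlin : Tendsto (fun k => p.linear d * p.linear (u k)) U
          (𝓝 (p.linear d * p.linear d)) :=
        ((p.linear.continuous_of_finiteDimensional.tendsto d).comp hud).const_mul _
      have hsq : 0 < p.linear d * p.linear d := mul_self_pos.2 hs
      have hinf := (hnorm.atTop_mul_pos hsq hlin).eventually_gt_atTop
        (p.linear d * p.linear d - p.linear d * p 0)
      filter_upwards [hinf] with k hk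
      refine Or.inr fun t ht h => ?_
      have hxk : p (x k) = p 0 + ‖x k‖ * p.linear (u k) := by
        rw [← p.eval_add_smul, zero_add, ← hxu]
      have h0 : p 0 + ‖x k‖ * p.linear (u k) + t * p.linear d = 0 := by
        rw [← hxk, ← p.eval_add_smul, hpa, h, sub_self]
      have h1 : p.linear d * p 0 + ‖x k‖ * (p.linear d * p.linear (u k))
          + t * (p.linear d * p.linear d) = 0 := by
        linear_combination p.linear d * h0
      nlinarith
  -- Any constant in [1/2, 1) would do: with `‖x k‖ > 1` it gives `‖x k - d‖ < ‖x k‖`.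
  have hinner : ∀ᶠ k in (U : Filter ℕ), (3 / 4 : ℝ) < inner ℝ (u k) d := by
    have h : Tendsto (fun k => inner ℝ (u k) d) U (𝓝 (inner ℝ d d)) :=
      hud.inner tendsto_const_nhds
    rw [real_inner_self_eq_norm_sq, hd1] at h
    exact h.eventually_const_lt (by norm_num)
  obtain ⟨k, hfk, hdk, hik, hk1⟩ :=
    (hfg₀.and (hdich.and (hinner.and (hnorm.eventually_gt_atTop 1)))).exists
  have hray : ∀ t : ℝ, -1 ≤ t → f (x k + t • d) = f (x k) + t * g₀.linear d := by
    have key := eqOn_of_isPreconnected_of_forall_eq_or_ne (A := Set.Ici (-1 : ℝ))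
      isPreconnected_Ici (f := fun t => f (x k + t • d)) (g₀ := fun t => g₀ (x k + t • d))
      (S := (fun (g : EuclideanSpace ℝ (Fin n) →ᵃ[ℝ] ℝ) (t : ℝ) => g (x k + t • d)) '' S)
      (hSfin.image _) (hfc.comp (by fun_prop)) ((hcont g₀).comp (by fun_prop))
      (by
        rintro _ ⟨g, -, rfl⟩
        exact (hcont g).comp (by fun_prop))
      (fun t => by
        obtain ⟨g, hg, h⟩ := hfS (x k + t • d)
        exact ⟨_, ⟨g, hg, rfl⟩, h⟩)
      (by
        rintro _ ⟨g, hg, rfl⟩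
        exact hdk g hg)
      (a := 0) (by simp) (by simpa using hfk)
    intro t ht
    rw [hfk, ← g₀.eval_add_smul]
    exact key t ht
  refine ⟨x k, d, g₀.linear d, ?_, fun t ht => hray t (by linarith)⟩
  have hlt : ‖x k + (-1 : ℝ) • d‖ < ‖x k‖ := by
    rw [neg_one_smul, ← sub_eq_add_neg]
    refine lt_of_pow_lt_pow_left₀ 2 (norm_nonneg _) ?_
    have hi : inner ℝ (x k) d = ‖x k‖ * inner ℝ (u k) d := by
      conv_lhs => rw [hxu k, real_inner_smul_left]
    rw [norm_sub_sq_real, hd1, hi]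
    nlinarith
  have := hxlt k _ hlt
  rw [hray (-1) le_rfl] at this
  linarith

/-! ### Bounds and homogeneity of the horizon function -/

theorem IsPiecewiseAffine.exists_growth_bound {f : EuclideanSpace ℝ (Fin n) → ℝ}
    (hf : IsPiecewiseAffine f) : ∃ C : ℝ, 0 ≤ C ∧ ∀ x, -(C * (1 + ‖x‖)) ≤ f x := by
  obtain ⟨-, S, hSfin, hfS⟩ := hf
  have hg : ∀ g : EuclideanSpace ℝ (Fin n) →ᵃ[ℝ] ℝ,
      ∃ C : ℝ, ∀ x, -(C * (1 + ‖x‖)) ≤ g x := by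
    intro g
    let L := LinearMap.toContinuousLinearMap g.linear
    refine ⟨|g 0| + ‖L‖, fun x => ?_⟩
    have h1 : g x = g 0 + g.linear x := by simpa using g.eval_add_smul 0 x 1
    have h2 : |g.linear x| ≤ ‖L‖ * ‖x‖ := L.le_opNorm x
    have h3 := neg_abs_le (g 0)
    have h4 := neg_abs_le (g.linear x)
    have h5 : 0 ≤ |g 0| * ‖x‖ := by positivity
    have h6 := norm_nonneg L
    nlinarith
  choose C hC using hg
  obtain ⟨B, hB⟩ := (hSfin.image C).bddAbove
  refine ⟨max B 0, le_max_right _ _, fun x => ?_⟩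
  obtain ⟨g, hgS, h⟩ := hfS x
  rw [h]
  refine le_trans ?_ (hC g x)
  have : C g ≤ max B 0 := (hB ⟨g, hgS, rfl⟩).trans (le_max_left _ _)
  have hx : 0 ≤ 1 + ‖x‖ := by positivity
  nlinarith

theorem le_horizonInf_iff {f : EuclideanSpace ℝ (Fin n) → ℝ} {ξ : EuclideanSpace ℝ (Fin n)}
    {δ c : ℝ} : (c : EReal) ≤ horizonInf f ξ δ ↔
      ∀ (l : ℝ) (x : EuclideanSpace ℝ (Fin n)), 0 < l → l < δ → ‖x - ξ‖ < δ →
        c ≤ l * f (l⁻¹ • x) := by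
  rw [horizonInf, le_sInf_iff]
  constructor
  · intro h l x h0 h1 h2
    exact EReal.coe_le_coe_iff.1 (h _ ⟨l, x, h0, h1, h2, rfl⟩)
  · rintro h _ ⟨l, x, h0, h1, h2, rfl⟩
    exact EReal.coe_le_coe_iff.2 (h l x h0 h1 h2)

theorem horizonInf_le_horizonFunction (f : EuclideanSpace ℝ (Fin n) → ℝ)
    (ξ : EuclideanSpace ℝ (Fin n)) {δ : ℝ} (hδ : 0 < δ) :
    horizonInf f ξ δ ≤ horizonFunction f ξ := by
  refine ge_of_tendsto (tendsto_horizonInf f ξ) ?_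
  filter_upwards [Ioo_mem_nhdsGT hδ] with ε hε
  exact horizonInf_antitone f ξ hε.2.le

theorem horizonFunction_nonneg_of_min {f : EuclideanSpace ℝ (Fin n) → ℝ}
    {x₀ : EuclideanSpace ℝ (Fin n)} (hx₀ : ∀ x, f x₀ ≤ f x) (ξ : EuclideanSpace ℝ (Fin n)) :
    0 ≤ horizonFunction f ξ := by
  have h : Tendsto (fun δ : ℝ => ((-(δ * |f x₀|) : ℝ) : EReal)) (𝓝[>] 0) (𝓝 ((0 : ℝ) : EReal)) := by
    refine (continuous_coe_real_ereal.tendsto 0).comp ?_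
    have : Continuous fun δ : ℝ => -(δ * |f x₀|) := by fun_prop
    simpa using (this.tendsto 0).mono_left nhdsWithin_le_nhds
  refine le_of_tendsto_of_tendsto h (tendsto_horizonInf f ξ) (Eventually.of_forall fun δ => ?_)
  refine le_horizonInf_iff.2 fun l x h0 h1 _ => ?_
  have h2 := hx₀ (l⁻¹ • x)
  have h3 := neg_abs_le (f x₀)
  have h4 := abs_nonneg (f x₀)
  nlinarith

/-- Linear growth gives `l * f (x / l) ≥ -C * (l + ‖x‖)`, which is bounded below near `ξ`.
Finiteness is needed because -∞ cannot be rescaled to -1. -/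
theorem IsPiecewiseAffine.horizonFunction_ne_bot {f : EuclideanSpace ℝ (Fin n) → ℝ}
    (hf : IsPiecewiseAffine f) (ξ : EuclideanSpace ℝ (Fin n)) : horizonFunction f ξ ≠ ⊥ := by
  obtain ⟨C, hC0, hC⟩ := hf.exists_growth_bound
  have h : ((-(C * (2 + ‖ξ‖)) : ℝ) : EReal) ≤ horizonInf f ξ 1 := by
    refine le_horizonInf_iff.2 fun l x h0 h1 h2 => ?_
    have h3 := mul_le_mul_of_nonneg_left (hC (l⁻¹ • x)) h0.le
    rw [norm_smul, norm_inv, Real.norm_of_nonneg h0.le] at h3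
    have h4 : l * -(C * (1 + l⁻¹ * ‖x‖)) = -(C * (l + ‖x‖)) := by
      field_simp
    have h5 : ‖x‖ ≤ ‖ξ‖ + ‖x - ξ‖ := norm_le_insert' x ξ
    nlinarith
  exact ne_bot_of_le_ne_bot (EReal.coe_ne_bot _)
    (h.trans (horizonInf_le_horizonFunction f ξ one_pos))

theorem horizonFunction_le_of_ray {f : EuclideanSpace ℝ (Fin n) → ℝ}
    {x d : EuclideanSpace ℝ (Fin n)} {m : ℝ}
    (h : ∀ t : ℝ, 0 ≤ t → f (x + t • d) = f x + t * m) : horizonFunction f d ≤ (m : EReal) := by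
  refine le_of_tendsto (tendsto_horizonInf f d) ?_
  filter_upwards [self_mem_nhdsWithin] with δ hδ
  have hδ : 0 < δ := hδ
  have hlim : Tendsto (fun l : ℝ => ((l * f x + m : ℝ) : EReal)) (𝓝[>] 0) (𝓝 (m : EReal)) := by
    refine (continuous_coe_real_ereal.tendsto m).comp ?_
    have : Continuous fun l : ℝ => l * f x + m := by fun_prop
    simpa using (this.tendsto 0).mono_left nhdsWithin_le_nhds
  have hsmall : ∀ᶠ l : ℝ in 𝓝[>] 0, ‖l • x‖ < δ := by
    have : Continuous fun l : ℝ => ‖l • x‖ := by fun_prop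
    have := (this.tendsto 0).mono_left (nhdsWithin_le_nhds (s := Set.Ioi 0))
    exact this.eventually_lt_const (by simpa using hδ)
  refine ge_of_tendsto hlim ?_
  filter_upwards [hsmall, Ioo_mem_nhdsGT hδ] with l hl hl'
  -- Dividing `d + l • x` by `l` lands exactly on the ray, at parameter `l⁻¹`.
  refine sInf_le ⟨l, d + l • x, hl'.1, hl'.2, by simpa using hl, ?_⟩
  have hl0 : l ≠ 0 := hl'.1.ne'
  have e : l⁻¹ • (d + l • x) = x + l⁻¹ • d := by
    rw [smul_add, smul_smul, inv_mul_cancel₀ hl0, one_smul, add_comm]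
  rw [e, h _ (inv_nonneg.2 hl'.1.le)]
  congr 1
  field_simp

/-- Half of positive homogeneity, by substituting `(l / s, x / s)` for `(l, x)`; the other half
follows by using `s⁻¹`. -/
theorem coe_mul_le_horizonFunction_smul {f : EuclideanSpace ℝ (Fin n) → ℝ}
    {ξ : EuclideanSpace ℝ (Fin n)} {s r : ℝ} (hs : 0 < s) (h : (r : EReal) ≤ horizonFunction f ξ) :
    ((s * r : ℝ) : EReal) ≤ horizonFunction f (s • ξ) := by
  refine le_of_forall_lt_imp_le_of_dense fun c hc => ?_
  induction c with
  | bot => exact bot_le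
  | top => exact absurd hc not_top_lt
  | coe c =>
    have hlt : ((c / s : ℝ) : EReal) < horizonFunction f ξ := by
      refine lt_of_lt_of_le (EReal.coe_lt_coe_iff.2 ?_) h
      rw [div_lt_iff₀' hs]
      exact EReal.coe_lt_coe_iff.1 hc
    obtain ⟨δ, hδinf, hδ⟩ := (((tendsto_horizonInf f ξ).eventually_const_lt hlt).and
      self_mem_nhdsWithin).exists
    refine le_trans (le_horizonInf_iff.2 fun l x h0 h1 h2 => ?_)
      (horizonInf_le_horizonFunction f (s • ξ) (mul_pos hs hδ))
    have hn : ‖s⁻¹ • x - ξ‖ < δ := by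
      have e : s⁻¹ • x - ξ = s⁻¹ • (x - s • ξ) := by
        rw [smul_sub, smul_smul, inv_mul_cancel₀ hs.ne', one_smul]
      rw [e, norm_smul, norm_inv, Real.norm_of_nonneg hs.le, inv_mul_lt_iff₀ hs]
      exact h2
    have key := le_horizonInf_iff.1 hδinf.le (l / s) (s⁻¹ • x) (div_pos h0 hs)
      ((div_lt_iff₀' hs).2 h1) hn
    have e : (l / s)⁻¹ • s⁻¹ • x = l⁻¹ • x := by
      rw [smul_smul, inv_div, div_mul_eq_mul_div, mul_inv_cancel₀ hs.ne', one_div]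
    rw [e, div_mul_eq_mul_div] at key
    exact (div_le_div_iff_of_pos_right hs).1 key

/-- The horizon function takes the value `-1` as soon as it takes a negative real value. -/
theorem exists_horizonFunction_eq_neg_one {f : EuclideanSpace ℝ (Fin n) → ℝ}
    {ξ : EuclideanSpace ℝ (Fin n)} {r : ℝ} (hr : r < 0) (h : horizonFunction f ξ = r) :
    ∃ η, horizonFunction f η = ((-1 : ℝ) : EReal) := by
  have hs : 0 < -r⁻¹ := neg_pos.2 (inv_lt_zero.2 hr)
  refine ⟨(-r⁻¹) • ξ, le_antisymm ?_ ?_⟩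
  · by_contra! hlt
    obtain ⟨c, hc1, hc2⟩ := EReal.lt_iff_exists_real_btwn.1 hlt
    have h1 := coe_mul_le_horizonFunction_smul (inv_pos.2 hs) hc2.le
    rw [smul_smul, inv_mul_cancel₀ hs.ne', one_smul, h, EReal.coe_le_coe_iff] at h1
    rw [EReal.coe_lt_coe_iff] at hc1
    rw [inv_neg, inv_inv] at h1
    nlinarith
  · have h1 := coe_mul_le_horizonFunction_smul hs h.ge
    rwa [neg_mul, inv_mul_cancel₀ hr.ne] at h1

end GeneralLemmas

theorem mainTheorem9 (n : ℕ) (f : EuclideanSpace ℝ (Fin n) → ℝ) (hf : IsPiecewiseAffine f) :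
    (∃ x₀ : EuclideanSpace ℝ (Fin n), ∀ x : EuclideanSpace ℝ (Fin n), f x₀ ≤ f x) ↔
      ¬ ∃ ξ : EuclideanSpace ℝ (Fin n), horizonFunction f ξ + 1 = 0 := by
  constructor
  · rintro ⟨x₀, hx₀⟩ ⟨ξ, hξ⟩
    have h : (0 : EReal) + 1 ≤ horizonFunction f ξ + 1 :=
      add_le_add_left (horizonFunction_nonneg_of_min hx₀ ξ) 1
    rw [hξ, zero_add] at h
    exact absurd h (not_le.2 zero_lt_one)
  · intro hno
    by_contra hmin
    obtain ⟨x, d, m, hm, hray⟩ := hf.exists_descending_ray hmin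
    have hle := horizonFunction_le_of_ray hray
    have hreal : ((horizonFunction f d).toReal : EReal) = horizonFunction f d :=
      EReal.coe_toReal (ne_top_of_le_ne_top (EReal.coe_ne_top m) hle)
        (hf.horizonFunction_ne_bot d)
    rw [← hreal, EReal.coe_le_coe_iff] at hle
    obtain ⟨η, hη⟩ := exists_horizonFunction_eq_neg_one (hle.trans_lt hm) hreal.symm
    refine hno ⟨η, ?_⟩
    rw [hη, ← EReal.coe_one, ← EReal.coe_add]
    simp
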